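/- Let $\mathcal B$ be a $\mathbb C$-linear pivotal bicategory: the categories $\mathcal B(a,b)$ are $\mathbb C$-linear and $\otimes$ is bilinear on 2-morphisms. Every 1-morphism $X\in\mathcal B(a,b)$ has a two-sided adjoint $X^\dagger\in\mathcal B(b,a)$ with $\widetilde{\mathrm{ev}}_X\colon X\otimes X^\dagger\to I_b$, $\widetilde{\mathrm{coev}}_X\colon I_a\to X^\dagger\otimes X$ (right adjoint) and $\mathrm{ev}_X\colon X^\dagger\otimes X\to I_a$, $\mathrm{coev}_X\colon I_b\to X\otimes X^\dagger$ (left adjoint). The duals of a 2-morphism induced by the left and by the right adjunctions agree, and so do the two induced maps $(Y\otimes X)^\dagger\to X^\dagger\otimes Y^\dagger$. (Associators and unitors are suppressed.) Let $\langle-\rangle_a\colon \mathrm{End}(I_a)\to\mathbb C$, $a\in\mathcal B$, be linear maps (bulk traces) satisfying the orientation-flip condition $$\big\langle \mathrm{ev}_X\circ(1_{X^\dagger}\otimes\Psi)\circ\widetilde{\mathrm{coev}}_X\big\rangle_a=\big\langle \widetilde{\mathrm{ev}}_X\circ(\Psi\otimes 1_{X^\dagger})\circ\mathrm{coev}_X\big\rangle_b\qquad\text{for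 all } X\in\mathcal B(a,b),\ \Psi\in\mathrm{End}(X).$$ Let $0\in\mathcal B$ be a trivial object: $\mathrm{End}(I_0)=\mathbb C\cdot 1$ with $\langle 1\rangle_0=1$, and every $V\in\mathcal B(0,0)$ is isomorphic to a direct sum of finitely many copies of $I_0$. Let $A\in\mathcal B(a,a)$ be a Frobenius algebra (multiplication $m$, unit $\eta$, comultiplication $\Delta$, counit $\varepsilon$) which is separable, i.e. $m\circ\Delta=1_A$; $A$ need not be symmetric. Let $Q,P\in\mathcal B(0,a)$ be left $A$-modules, with action $\mathrm{act}_Q\colon A\otimes Q\to Q$ of $A$ on $Q$ and similarly for $P$, and write $\mathrm{Hom}_A(Q,P)$ for the space of module maps. For $\Psi\in\mathrm{End}(Q)$ put $$\beta^Q(\Psi)=(1_A\otimes\widetilde{\mathrm{ev}}_Q)\circ(1_A\otimes \mathrm{act}_Q\otimes 1_{Q^\dagger})\circ\big((\Delta\circ\eta)\otimes\Psi\otimes 1_{Q^\dagger}\big)\circ\mathrm{coev}_Q\in\mathrm{Hom}(I_a,A),$$ and for $\alpha,\beta\in\mathrm{Hom}(I_a,A)$ put $\alpha\beta=m\circ(\alpha\otimes\beta)$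 and $\langle\alpha\beta\rangle_{(a,A)}=\langle\varepsilon\circ(\alpha\beta)\rangle_a$. Then, for all $\Phi\in\mathrm{End}_A(Q)$ and $\Psi\in\mathrm{End}_A(P)$, the vector space $\mathrm{Hom}_A(Q,P)$ is finite-dimensional and the Cardy condition holds: $$\big\langle\beta^Q(\Phi)\,\beta^P(\Psi)\big\rangle_{(a,A)}=\mathrm{tr}\big({}_\Psi m_\Phi\big),$$ where ${}_\Psi m_\Phi\colon\mathrm{Hom}_A(Q,P)\to\mathrm{Hom}_A(Q,P)$, $\alpha\mapsto\Psi\circ\alpha\circ\Phi$, and $\mathrm{tr}$ is the $\mathbb C$-linear trace. -/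

import Mathlib

open CategoryTheory Bicategory

/-!
Conventions. Mathlib composes 1-morphisms in diagrammatic order, so the tensor product `Y ⊗ X` of
`X ∈ B(a,b)` and `Y ∈ B(b,c)` ("first `X`, then `Y`") is `X ≫ Y`. The *left* tensor factor `Y`
is thus the *right* factor of `X ≫ Y`.
-/

universe w v u

namespace GeneralisedOrbifold

/-- A `ℂ`-linear bicategory: the categories `B(a,b)` are `ℂ`-linear and the tensor product of
2-morphisms is `ℂ`-bilinear. -/
class LinearBicategory (B : Type u) [Bicategory.{w, v} B] where
  preadditive : ∀ a b : B, Preadditive (a ⟶ b)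
  linear : ∀ a b : B, Linear ℂ (a ⟶ b)
  whiskerLeft_add : ∀ {a b c : B} (X : a ⟶ b) {Y Z : b ⟶ c} (Φ Ψ : Y ⟶ Z),
    X ◁ (Φ + Ψ) = X ◁ Φ + X ◁ Ψ
  whiskerLeft_smul : ∀ {a b c : B} (X : a ⟶ b) {Y Z : b ⟶ c} (r : ℂ) (Φ : Y ⟶ Z),
    X ◁ (r • Φ) = r • X ◁ Φ
  add_whiskerRight : ∀ {a b c : B} {X Y : a ⟶ b} (Φ Ψ : X ⟶ Y) (Z : b ⟶ c),
    (Φ + Ψ) ▷ Z = Φ ▷ Z + Ψ ▷ Z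
  smul_whiskerRight : ∀ {a b c : B} {X Y : a ⟶ b} (r : ℂ) (Φ : X ⟶ Y) (Z : b ⟶ c),
    (r • Φ) ▷ Z = r • Φ ▷ Z

attribute [reducible] LinearBicategory.preadditive LinearBicategory.linear
attribute [instance] LinearBicategory.preadditive LinearBicategory.linear

/-- A pivotal bicategory. Every `X ∈ B(a,b)` has an `X† ∈ B(b,a)` (here `dual X`) which is both its
right adjoint, with `coev~ : I_a ⟶ X† ⊗ X` and `ev~ : X ⊗ X† ⟶ I_b`, and its left adjoint, with
`coev : I_b ⟶ X ⊗ X†` and `ev : X† ⊗ X ⟶ I_a`. The two induced duals of a 2-morphism agree, and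
so do the two induced maps `(Y ⊗ X)† ⟶ X† ⊗ Y†`. -/
class PivotalBicategory (B : Type u) [Bicategory.{w, v} B] where
  dual : ∀ {a b : B}, (a ⟶ b) → (b ⟶ a)
  /-- unit `coev~`, counit `ev~` -/
  adjR : ∀ {a b : B} (X : a ⟶ b), Bicategory.Adjunction X (dual X)
  /-- unit `coev`, counit `ev` -/
  adjL : ∀ {a b : B} (X : a ⟶ b), Bicategory.Adjunction (dual X) X
  /-- `Φ† = †Φ : Y† ⟶ X†` for `Φ : X ⟶ Y` -/
  dual_hom : ∀ {a b : B} {X Y : a ⟶ b} (Φ : X ⟶ Y),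
    conjugateEquiv (adjR Y) (adjR X) Φ = (conjugateEquiv (adjL X) (adjL Y)).symm Φ
  /-- the maps `(Y ⊗ X)† ⟶ X† ⊗ Y†` from right and from left adjunctions agree -/
  pivotal : ∀ {a b c : B} (X : a ⟶ b) (Y : b ⟶ c),
    conjugateEquiv (adjR (X ≫ Y)) ((adjR X).comp (adjR Y)) (𝟙 (X ≫ Y)) =
      (conjugateEquiv ((adjL Y).comp (adjL X)) (adjL (X ≫ Y))).symm (𝟙 (X ≫ Y))

section Pivotal

variable {B : Type u} [Bicategory.{w, v} B] [PivotalBicategory B]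

open PivotalBicategory

/-- The counterclockwise loop `ev_X ∘ (X† ⊗ Ψ) ∘ coev~_X ∈ End(I_a)`: the line `X`, carrying
`Ψ ∈ End(X)`, goes up on the right and comes back as `X†` on the left. -/
def loopLeft {a b : B} (X : a ⟶ b) (Ψ : X ⟶ X) : 𝟙 a ⟶ 𝟙 a :=
  (adjR X).unit ≫ Ψ ▷ dual X ≫ (adjL X).counit

/-- The clockwise loop `ev~_X ∘ (Ψ ⊗ X†) ∘ coev_X ∈ End(I_b)`: the line `X`, carrying
`Ψ ∈ End(X)`, goes up on the left and comes back as `X†` on the right. -/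
def loopRight {a b : B} (X : a ⟶ b) (Ψ : X ⟶ X) : 𝟙 b ⟶ 𝟙 b :=
  (adjL X).unit ≫ dual X ◁ Ψ ≫ (adjR X).counit

/-- The orientation-flip condition on a family of bulk traces `⟨-⟩_a : End(I_a) ⟶ ℂ`. -/
def OrientationFlip [LinearBicategory B] (tr : ∀ a : B, (𝟙 a ⟶ 𝟙 a) →ₗ[ℂ] ℂ) : Prop :=
  ∀ (a b : B) (X : a ⟶ b) (Ψ : X ⟶ X), tr a (loopLeft X Ψ) = tr b (loopRight X Ψ)

/-- `o` is the trivial theory: `End(I_o) = ℂ` via the bulk trace `⟨-⟩_o`, and every `V ∈ B(o,o)`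
is a direct sum of finitely many copies of `I_o`, i.e. `B(o,o)` consists of finite-dimensional
vector spaces. -/
structure IsTrivialTheory [LinearBicategory B] (tr : ∀ a : B, (𝟙 a ⟶ 𝟙 a) →ₗ[ℂ] ℂ) (o : B) :
    Prop where
  eq_smul_id : ∀ z : 𝟙 o ⟶ 𝟙 o, ∃ r : ℂ, z = r • 𝟙 (𝟙 o)
  tr_id : tr o (𝟙 (𝟙 o)) = 1
  directSum : ∀ V : o ⟶ o, ∃ (n : ℕ) (ι : Fin n → (𝟙 o ⟶ V)) (π : Fin n → (V ⟶ 𝟙 o)),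
    (∀ k l, ι k ≫ π l = if k = l then 𝟙 (𝟙 o) else 0) ∧ ∑ k, π k ≫ ι k = 𝟙 V

end Pivotal

section Algebras

variable {B : Type u} [Bicategory.{w, v} B]

/-- A Frobenius algebra `A ∈ B(a,a)`: an algebra and a coalgebra such that
`(1 ⊗ m) ∘ (Δ ⊗ 1) = Δ ∘ m = (m ⊗ 1) ∘ (1 ⊗ Δ)`. -/
structure FrobeniusAlgebra (a : B) where
  X : a ⟶ a
  mul : X ≫ X ⟶ X
  one : 𝟙 a ⟶ X
  comul : X ⟶ X ≫ X
  counit : X ⟶ 𝟙 a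
  mul_assoc : mul ▷ X ≫ mul = (α_ X X X).hom ≫ X ◁ mul ≫ mul
  one_mul : (ρ_ X).inv ≫ X ◁ one ≫ mul = 𝟙 X
  mul_one : (λ_ X).inv ≫ one ▷ X ≫ mul = 𝟙 X
  comul_assoc : comul ≫ comul ▷ X ≫ (α_ X X X).hom = comul ≫ X ◁ comul
  counit_comul : comul ≫ X ◁ counit ≫ (ρ_ X).hom = 𝟙 X
  comul_counit : comul ≫ counit ▷ X ≫ (λ_ X).hom = 𝟙 X
  frobenius_left : X ◁ comul ≫ (α_ X X X).inv ≫ mul ▷ X = mul ≫ comul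
  frobenius_right : comul ▷ X ≫ (α_ X X X).hom ≫ X ◁ mul = mul ≫ comul

/-- `A` is separable: `m ∘ Δ = 1`. -/
def FrobeniusAlgebra.IsSeparable {a : B} (A : FrobeniusAlgebra a) : Prop :=
  A.comul ≫ A.mul = 𝟙 A.X

/-- A left `A`-module `Q ∈ B(o,a)`, with action `A ⊗ Q ⟶ Q`. -/
structure LeftModule {a : B} (A : FrobeniusAlgebra a) (o : B) where
  Q : o ⟶ a
  act : Q ≫ A.X ⟶ Q
  act_act : act ▷ A.X ≫ act = (α_ Q A.X A.X).hom ≫ Q ◁ A.mul ≫ act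
  one_act : (ρ_ Q).inv ≫ Q ◁ A.one ≫ act = 𝟙 Q

variable {a o : B} {A : FrobeniusAlgebra a}

/-- The left coaction `Q ⟶ A ⊗ Q` of the Frobenius algebra `A`: create `Δ ∘ η : I_a ⟶ A ⊗ A` to
the left of `Q` and let its right tensor factor act on `Q`. -/
def LeftModule.coact (M : LeftModule A o) : M.Q ⟶ M.Q ≫ A.X :=
  (ρ_ M.Q).inv ≫ M.Q ◁ (A.one ≫ A.comul) ≫ (α_ M.Q A.X A.X).inv ≫ M.act ▷ A.X

/-- The boundary-bulk map `β^Q : End(Q) ⟶ Hom(I_a, A)`: a clockwise `Q`-loop carrying `Ψ` and,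
above `Ψ`, the coaction, whose `A`-line leaves to the left of the loop. -/
def betaUp [PivotalBicategory B] (M : LeftModule A o) (Ψ : M.Q ⟶ M.Q) : 𝟙 a ⟶ A.X :=
  (PivotalBicategory.adjL M.Q).unit ≫
    PivotalBicategory.dual M.Q ◁ (Ψ ≫ M.coact) ≫
      (α_ (PivotalBicategory.dual M.Q) M.Q A.X).inv ≫
        (PivotalBicategory.adjR M.Q).counit ▷ A.X ≫ (λ_ A.X).hom

/-- The product `α · β = m ∘ (α ⊗ β)` on `Hom(I_a, A)`. -/
def bulkMul (A : FrobeniusAlgebra a) (α β : 𝟙 a ⟶ A.X) : 𝟙 a ⟶ A.X :=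
  (λ_ (𝟙 a)).inv ≫ β ▷ 𝟙 a ≫ A.X ◁ α ≫ A.mul

variable [LinearBicategory B]

/-- The trace `⟨α⟩_{(a,A)} = ⟨ε ∘ α⟩_a` on `Hom(I_a, A)`; the bulk pairing is
`⟨α, β⟩_{(a,A)} = ⟨α · β⟩_{(a,A)}`. -/
def orbifoldTrace (tr : ∀ a : B, (𝟙 a ⟶ 𝟙 a) →ₗ[ℂ] ℂ) (A : FrobeniusAlgebra a)
    (α : 𝟙 a ⟶ A.X) : ℂ :=
  tr a (α ≫ A.counit)

/-- `Hom_A(M, N)`, the space of module maps. -/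
def moduleHom (M N : LeftModule A o) : Submodule ℂ (M.Q ⟶ N.Q) where
  carrier := {f | f ▷ A.X ≫ N.act = M.act ≫ f}
  add_mem' := by
    intro f g hf hg
    simp only [Set.mem_ofPred_eq] at *
    rw [LinearBicategory.add_whiskerRight, Preadditive.add_comp, Preadditive.comp_add, hf, hg]
  zero_mem' := by
    have h := LinearBicategory.smul_whiskerRight (0 : ℂ) (0 : M.Q ⟶ N.Q) A.X
    simp only [zero_smul] at h
    simp only [Set.mem_ofPred_eq]
    rw [h, Limits.zero_comp, Limits.comp_zero]
  smul_mem' := by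
    intro r f hf
    simp only [Set.mem_ofPred_eq] at *
    rw [LinearBicategory.smul_whiskerRight, Linear.smul_comp, Linear.comp_smul, hf]

/-- The linear map `_Ψ m_Φ : α ↦ Ψ ∘ α ∘ Φ` on `Hom_A(Q, P)` for `Φ ∈ End_A(Q)` and
`Ψ ∈ End_A(P)`. -/
def sandwich (Q P : LeftModule A o) (Φ : moduleHom Q Q) (Ψ : moduleHom P P) :
    moduleHom Q P →ₗ[ℂ] moduleHom Q P where
  toFun f := ⟨Φ.1 ≫ f.1 ≫ Ψ.1, by
    have h1 : Φ.1 ▷ A.X ≫ Q.act = Q.act ≫ Φ.1 := Φ.2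
    have h2 : f.1 ▷ A.X ≫ P.act = Q.act ≫ f.1 := f.2
    have h3 : Ψ.1 ▷ A.X ≫ P.act = P.act ≫ Ψ.1 := Ψ.2
    change (Φ.1 ≫ f.1 ≫ Ψ.1) ▷ A.X ≫ P.act = Q.act ≫ Φ.1 ≫ f.1 ≫ Ψ.1
    rw [comp_whiskerRight, comp_whiskerRight, Category.assoc, Category.assoc, h3,
      reassoc_of% h2, reassoc_of% h1]⟩
  map_add' f g := by
    ext
    simp [Preadditive.add_comp, Preadditive.comp_add]
  map_smul' r f := by
    ext
    simp [Linear.smul_comp, Linear.comp_smul]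

end Algebras

end GeneralisedOrbifold

/-! Both sides expand into the same finite sum of loop scalars in `End(I_0)`. Bending gives
`Hom(Q,P) ≅ Hom(I_0, P ⊗ Q†)`. A splitting `∑ π_k ≫ ι_k = 1` of `P ⊗ Q†` through copies of `I_0`
unbends to `x_k : Q ⟶ P` and `y_k : P ⟶ Q`, and every `f : Q ⟶ P` equals `∑ ⟨loop (y_k ≫ f)⟩ x_k`
(`sum_loopCoord_smul`). So `Hom(Q,P)` is finite-dimensional and an endomorphism `T` has trace `∑
⟨loop (y_k ≫ T x_k)⟩`.

Separability makes `average` a projection `E` of `Hom(Q,P)` onto `Hom_A(Q,P)`, so the Cardy trace is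
that of `x ↦ Φ ≫ E x ≫ Ψ` on `Hom(Q,P)`.

On the bulk side, the Frobenius pairing turns the coaction in `β^P(Ψ)` into the action of `β^Q(Φ)`
on `P` (`bulkMul_betaUp_counit`). The orientation flip moves the resulting `P`-loop into `End(I_0)`.
Cutting the strands `P ⊗ Q†` along the splitting turns the action of `β^Q(Φ)` into `∑ y_k ≫ Φ ≫ E
x_k` (`whiskerLeft_betaUp_act_eq_sum`), which gives the same sum. -/

namespace GeneralisedOrbifold

/-! ### Sliding 2-morphisms around cups and caps -/

section Mates

variable {B : Type u} [Bicategory.{w, v} B] {c d : B}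
  {l₁ l₂ : c ⟶ d} {r₁ r₂ : d ⟶ c} (adj₁ : Bicategory.Adjunction l₁ r₁)
  (adj₂ : Bicategory.Adjunction l₂ r₂)

theorem unit_conjugateEquiv (α : l₂ ⟶ l₁) :
    adj₁.unit ≫ l₁ ◁ conjugateEquiv adj₁ adj₂ α = adj₂.unit ≫ α ▷ r₂ := by
  rw [conjugateEquiv_apply']
  calc
    _ = 𝟙 _ ⊗≫ (adj₁.unit ▷ 𝟙 c ≫ (l₁ ≫ r₁) ◁ (adj₂.unit ≫ α ▷ r₂)) ⊗≫
          l₁ ◁ adj₁.counit ▷ r₂ ⊗≫ 𝟙 _ := by bicategory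
    _ = adj₂.unit ≫ α ▷ r₂ ⊗≫ leftZigzag adj₁.unit adj₁.counit ▷ r₂ ⊗≫ 𝟙 _ := by
      rw [← whisker_exchange]; bicategory
    _ = _ := by
      rw [adj₁.left_triangle]; bicategory

theorem conjugateEquiv_symm_counit (α : r₁ ⟶ r₂) :
    r₁ ◁ (conjugateEquiv adj₁ adj₂).symm α ≫ adj₁.counit = α ▷ l₂ ≫ adj₂.counit := by
  rw [conjugateEquiv_symm_apply']
  calc
    _ = 𝟙 _ ⊗≫ r₁ ◁ adj₁.unit ▷ l₂ ⊗≫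
          ((r₁ ≫ l₁) ◁ (α ▷ l₂ ≫ adj₂.counit) ≫ adj₁.counit ▷ 𝟙 d) ⊗≫ 𝟙 _ := by bicategory
    _ = 𝟙 _ ⊗≫ rightZigzag adj₁.unit adj₁.counit ▷ l₂ ⊗≫ α ▷ l₂ ≫ adj₂.counit := by
      rw [whisker_exchange]; bicategory
    _ = _ := by
      rw [adj₁.right_triangle]; bicategory

end Mates

/-! ### Cyclicity of loops, and bending between `Hom(Q,P)` and `P ⊗ Q†` -/

section Loops

open PivotalBicategory

variable {B : Type u} [Bicategory.{w, v} B] [PivotalBicategory B] {a o : B}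

/-- `g` slides through the cup as its right-adjunction dual and returns through the cap as its
left-adjunction dual; `dual_hom` identifies the two. -/
theorem loopLeft_comp_comm {X Y : o ⟶ a} (g : X ⟶ Y) (h : Y ⟶ X) :
    loopLeft X (g ≫ h) = loopLeft Y (h ≫ g) := by
  have h1 := unit_conjugateEquiv (adjR Y) (adjR X) g
  have h2 := conjugateEquiv_symm_counit (adjL X) (adjL Y) g
  rw [← dual_hom] at h2
  simp only [loopLeft, comp_whiskerRight, Category.assoc]
  rw [← reassoc_of% h1, ← h2, whisker_exchange_assoc]

/-- The 2-morphism `Q ⟶ P` corresponding to `ι : 1 ⟶ P ⊗ Q†`. -/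
def unbendUnit {Q P : o ⟶ a} (ι : 𝟙 o ⟶ P ≫ dual Q) : Q ⟶ P :=
  (λ_ Q).inv ≫ ι ▷ Q ≫ (α_ P (dual Q) Q).hom ≫ P ◁ (adjR Q).counit ≫ (ρ_ P).hom

/-- The 2-morphism `P ⟶ Q` corresponding to `π : P ⊗ Q† ⟶ 1`. -/
def unbendCounit {Q P : o ⟶ a} (π : P ≫ dual Q ⟶ 𝟙 o) : P ⟶ Q :=
  (ρ_ P).inv ≫ P ◁ (adjL Q).unit ≫ (α_ P (dual Q) Q).inv ≫ π ▷ Q ≫ (λ_ Q).hom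

theorem unbendUnit_unit {Q P : o ⟶ a} (f : Q ⟶ P) :
    unbendUnit ((adjR Q).unit ≫ f ▷ dual Q) = f := by
  unfold unbendUnit
  calc
    _ = 𝟙 _ ⊗≫ (adjR Q).unit ▷ Q ⊗≫ (f ▷ (dual Q ≫ Q) ≫ P ◁ (adjR Q).counit) ⊗≫ 𝟙 _ := by
      bicategory
    _ = 𝟙 _ ⊗≫ leftZigzag (adjR Q).unit (adjR Q).counit ⊗≫ f := by
      rw [← whisker_exchange]; bicategory
    _ = f := by
      rw [(adjR Q).left_triangle]; bicategory

theorem unbendCounit_whiskerRight {Q P : o ⟶ a} (π : P ≫ dual Q ⟶ 𝟙 o) :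
    unbendCounit π ▷ dual Q ≫ (adjL Q).counit = π := by
  unfold unbendCounit
  calc
    _ = 𝟙 _ ⊗≫ P ◁ (adjL Q).unit ▷ dual Q ⊗≫ (π ▷ (Q ≫ dual Q) ≫ 𝟙 o ◁ (adjL Q).counit)
          ⊗≫ 𝟙 _ := by
      bicategory
    _ = 𝟙 _ ⊗≫ P ◁ leftZigzag (adjL Q).unit (adjL Q).counit ⊗≫ π := by
      rw [← whisker_exchange]; bicategory
    _ = π := by
      rw [(adjL Q).left_triangle]; bicategory

/-- Isolates `π ≫ ι` as one factor in which the expression is linear. Summing over a splitting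
replaces it by the identity, which leaves a closed `Q`-loop beside `P`. -/
theorem unbendCounit_comp_unbendUnit {Q P : o ⟶ a} (A : a ⟶ a) (π : P ≫ dual Q ⟶ 𝟙 o)
    (ι : 𝟙 o ⟶ P ≫ dual Q) (h : Q ⟶ Q ≫ A) :
    unbendCounit π ≫ h ≫ unbendUnit ι ▷ A =
      ((ρ_ P).inv ≫ P ◁ (adjL Q).unit ≫ (α_ P (dual Q) Q).inv ≫ (P ≫ dual Q) ◁ h) ≫
        (π ≫ ι) ▷ (Q ≫ A) ≫
          (α_ (P ≫ dual Q) Q A).inv ≫ (α_ P (dual Q) Q).hom ▷ A ≫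
            (P ◁ (adjR Q).counit) ▷ A ≫ (ρ_ P).hom ▷ A := by
  unfold unbendCounit unbendUnit
  calc
    _ = 𝟙 _ ⊗≫ P ◁ (adjL Q).unit ⊗≫ (π ▷ Q ≫ 𝟙 o ◁ h) ⊗≫ ι ▷ Q ▷ A ⊗≫
          P ◁ (adjR Q).counit ▷ A ⊗≫ 𝟙 _ := by bicategory
    _ = _ := by
      rw [← whisker_exchange]; bicategory

theorem unbend_id_eq_whiskerLeft_loop {Q P : o ⟶ a} (A : a ⟶ a) (h : Q ⟶ Q ≫ A) :
    ((ρ_ P).inv ≫ P ◁ (adjL Q).unit ≫ (α_ P (dual Q) Q).inv ≫ (P ≫ dual Q) ◁ h) ≫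
        (𝟙 (P ≫ dual Q)) ▷ (Q ≫ A) ≫
          (α_ (P ≫ dual Q) Q A).inv ≫ (α_ P (dual Q) Q).hom ▷ A ≫
            (P ◁ (adjR Q).counit) ▷ A ≫ (ρ_ P).hom ▷ A =
      (ρ_ P).inv ≫ P ◁ ((adjL Q).unit ≫ dual Q ◁ h ≫ (α_ (dual Q) Q A).inv ≫
        (adjR Q).counit ▷ A ≫ (λ_ A).hom) := by
  bicategory

end Loops

/-! ### Frobenius copairing, coaction and averaging -/

section Frobenius

variable {B : Type u} [Bicategory.{w, v} B] {a o : B} {A : FrobeniusAlgebra a}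

theorem FrobeniusAlgebra.copair_mul_left (A : FrobeniusAlgebra a) :
    (ρ_ A.X).inv ≫ A.X ◁ (A.one ≫ A.comul) ≫ (α_ A.X A.X A.X).inv ≫ A.mul ▷ A.X = A.comul := by
  have h := A.one_mul
  have h2 := A.frobenius_left
  rw [whiskerLeft_comp, Category.assoc, h2, reassoc_of% h]

theorem FrobeniusAlgebra.copair_mul_right (A : FrobeniusAlgebra a) :
    (λ_ A.X).inv ≫ (A.one ≫ A.comul) ▷ A.X ≫ (α_ A.X A.X A.X).hom ≫ A.X ◁ A.mul = A.comul := by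
  have h := A.mul_one
  have h2 := A.frobenius_right
  rw [comp_whiskerRight, Category.assoc, h2, reassoc_of% h]

/-- A snake identity: `Δ ∘ η` is the copairing inverse to the pairing `ε ∘ m`. -/
theorem FrobeniusAlgebra.copair_pairing (A : FrobeniusAlgebra a) (α : 𝟙 a ⟶ A.X) :
    A.one ≫ A.comul ≫ A.X ◁ ((ρ_ A.X).inv ≫ A.X ◁ α ≫ A.mul ≫ A.counit) ≫ (ρ_ A.X).hom = α := by
  have h := A.mul_one
  have h2 := A.frobenius_right
  have h3 := A.counit_comul
  calc
    _ = A.one ≫ 𝟙 _ ⊗≫ (A.comul ▷ 𝟙 a ≫ (A.X ≫ A.X) ◁ α) ≫ (α_ A.X A.X A.X).hom ≫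
          A.X ◁ A.mul ≫ A.X ◁ A.counit ≫ (ρ_ A.X).hom := by bicategory
    _ = 𝟙 _ ⊗≫ (A.one ▷ 𝟙 a ≫ A.X ◁ α) ≫ A.comul ▷ A.X ≫ (α_ A.X A.X A.X).hom ≫
          A.X ◁ A.mul ≫ A.X ◁ A.counit ≫ (ρ_ A.X).hom := by
      rw [← whisker_exchange]; bicategory
    _ = 𝟙 _ ⊗≫ (A.one ▷ 𝟙 a ≫ A.X ◁ α) ≫ A.mul := by
      rw [reassoc_of% h2, h3, Category.comp_id]
    _ = α ≫ (λ_ A.X).inv ≫ A.one ▷ A.X ≫ A.mul := by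
      rw [← whisker_exchange]; bicategory
    _ = α := by rw [h, Category.comp_id]

/-- Multiplying `Δ ∘ η` by `A` on either outer side gives `Δ`, so an `A`-line can pass from one leg
of the copairing to the other. -/
theorem LeftModule.act_coact (M : LeftModule A o) :
    M.coact ▷ A.X ≫ (α_ M.Q A.X A.X).hom ≫ M.Q ◁ A.mul = M.act ≫ M.coact := by
  have h := M.act_act
  calc
    _ = M.Q ◁ ((λ_ A.X).inv ≫ (A.one ≫ A.comul) ▷ A.X ≫ (α_ A.X A.X A.X).hom ≫ A.X ◁ A.mul) ⊗≫
          M.act ▷ A.X := by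
      unfold LeftModule.coact
      calc
        _ = M.Q ◁ ((λ_ A.X).inv ≫ (A.one ≫ A.comul) ▷ A.X) ⊗≫
              (M.act ▷ (A.X ≫ A.X) ≫ M.Q ◁ A.mul) := by bicategory
        _ = _ := by rw [← whisker_exchange]; bicategory
    _ = M.Q ◁ ((ρ_ A.X).inv ≫ A.X ◁ (A.one ≫ A.comul) ≫ (α_ A.X A.X A.X).inv ≫ A.mul ▷ A.X) ⊗≫
          M.act ▷ A.X := by
      rw [A.copair_mul_left, A.copair_mul_right]
    _ = 𝟙 _ ⊗≫ M.Q ◁ A.X ◁ (A.one ≫ A.comul) ⊗≫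
          ((α_ M.Q A.X A.X).hom ≫ M.Q ◁ A.mul ≫ M.act) ▷ A.X := by bicategory
    _ = 𝟙 _ ⊗≫ ((M.Q ≫ A.X) ◁ (A.one ≫ A.comul) ≫ M.act ▷ (A.X ≫ A.X)) ⊗≫ M.act ▷ A.X := by
      rw [← h]; bicategory
    _ = _ := by
      rw [whisker_exchange]; unfold LeftModule.coact; bicategory

/-- Acting with both legs of `Δ ∘ η` is acting with `m ∘ Δ ∘ η = η`. -/
theorem LeftModule.coact_act (hA : A.IsSeparable) (M : LeftModule A o) :
    M.coact ≫ M.act = 𝟙 M.Q := by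
  have h := M.act_act
  have h1 := M.one_act
  unfold FrobeniusAlgebra.IsSeparable at hA
  unfold LeftModule.coact
  simp only [Category.assoc]
  rw [h, Iso.inv_hom_id_assoc, ← whiskerLeft_comp_assoc, Category.assoc, hA, Category.comp_id, h1]

theorem LeftModule.coact_pairing (M : LeftModule A o) (α : 𝟙 a ⟶ A.X) :
    M.coact ≫ M.Q ◁ ((ρ_ A.X).inv ≫ A.X ◁ α ≫ A.mul ≫ A.counit) ≫ (ρ_ M.Q).hom =
      (ρ_ M.Q).inv ≫ M.Q ◁ α ≫ M.act := by
  have h := A.copair_pairing α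
  conv_rhs => rw [← h]
  unfold LeftModule.coact
  generalize (ρ_ A.X).inv ≫ A.X ◁ α ≫ A.mul ≫ A.counit = x
  calc
    _ = (ρ_ M.Q).inv ≫ M.Q ◁ (A.one ≫ A.comul) ⊗≫ (M.act ▷ A.X ≫ M.Q ◁ x) ⊗≫ 𝟙 _ := by
      bicategory
    _ = _ := by rw [← whisker_exchange]; bicategory

/-- The averaging map `Hom(Q, P) ⟶ Hom_A(Q, P)` given by coaction, `f` and action. -/
def average (Q P : LeftModule A o) (f : Q.Q ⟶ P.Q) : Q.Q ⟶ P.Q :=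
  Q.coact ≫ f ▷ A.X ≫ P.act

theorem average_isModuleHom (Q P : LeftModule A o) (f : Q.Q ⟶ P.Q) :
    average Q P f ▷ A.X ≫ P.act = Q.act ≫ average Q P f := by
  have h := P.act_act
  have h2 := Q.act_coact
  unfold average
  simp only [comp_whiskerRight, Category.assoc]
  rw [h, ← reassoc_of% h2, whisker_exchange_assoc]
  simp

theorem average_eq_self (hA : A.IsSeparable) (Q P : LeftModule A o) (f : Q.Q ⟶ P.Q)
    (hf : f ▷ A.X ≫ P.act = Q.act ≫ f) : average Q P f = f := by
  have h := Q.coact_act hA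
  rw [average, hf, reassoc_of% h]

theorem bulkMul_betaUp_counit [PivotalBicategory B] (P : LeftModule A o) (α : 𝟙 a ⟶ A.X)
    (Ψ : P.Q ⟶ P.Q) :
    bulkMul A α (betaUp P Ψ) ≫ A.counit =
      loopRight P.Q (Ψ ≫ (ρ_ P.Q).inv ≫ P.Q ◁ α ≫ P.act) := by
  rw [← P.coact_pairing]
  unfold bulkMul betaUp loopRight
  trans (PivotalBicategory.adjL P.Q).unit ≫ PivotalBicategory.dual P.Q ◁ (Ψ ≫ P.coact) ≫
      (α_ (PivotalBicategory.dual P.Q) P.Q A.X).inv ≫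
        (PivotalBicategory.adjR P.Q).counit ▷ A.X ≫
          𝟙 a ◁ ((ρ_ A.X).inv ≫ A.X ◁ α ≫ A.mul ≫ A.counit) ≫ (λ_ (𝟙 a)).hom
  · bicategory
  · rw [← whisker_exchange_assoc]
    generalize (ρ_ A.X).inv ≫ A.X ◁ α ≫ A.mul ≫ A.counit = x
    bicategory

end Frobenius

/-! ### Dual coordinates on `Hom(Q,P)` from the splitting of `P ⊗ Q†` -/

section Linear

open PivotalBicategory

variable {B : Type u} [Bicategory.{w, v} B] [LinearBicategory B] {a o : B}

/-- Right whiskering as a linear map. -/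
def whiskerRightₗ {a b c : B} (X Y : a ⟶ b) (Z : b ⟶ c) : (X ⟶ Y) →ₗ[ℂ] (X ≫ Z ⟶ Y ≫ Z) where
  toFun f := f ▷ Z
  map_add' f g := LinearBicategory.add_whiskerRight f g Z
  map_smul' r f := LinearBicategory.smul_whiskerRight r f Z

theorem sum_whiskerRight {a b c : B} {X Y : a ⟶ b} (Z : b ⟶ c) {ι : Type*} (s : Finset ι)
    (f : ι → (X ⟶ Y)) : (∑ i ∈ s, f i) ▷ Z = ∑ i ∈ s, f i ▷ Z :=
  map_sum (whiskerRightₗ X Y Z) f s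

/-- `average` as a linear map onto the space of module maps. -/
def averageₗ {A : FrobeniusAlgebra a} (Q P : LeftModule A o) :
    (Q.Q ⟶ P.Q) →ₗ[ℂ] moduleHom Q P where
  toFun f := ⟨average Q P f, average_isModuleHom Q P f⟩
  map_add' f g := by
    ext
    simp [average, LinearBicategory.add_whiskerRight]
  map_smul' r f := by
    ext
    simp [average, LinearBicategory.smul_whiskerRight]

variable {tr : ∀ a : B, (𝟙 a ⟶ 𝟙 a) →ₗ[ℂ] ℂ}

theorem IsTrivialTheory.eq_tr_smul (ho : IsTrivialTheory tr o) (z : 𝟙 o ⟶ 𝟙 o) :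
    z = tr o z • 𝟙 (𝟙 o) := by
  obtain ⟨r, rfl⟩ := ho.eq_smul_id z
  simp [ho.tr_id]

variable [PivotalBicategory B]

/-- `unbendUnit` as a linear map. -/
def unbendUnitₗ (Q P : o ⟶ a) : (𝟙 o ⟶ P ≫ dual Q) →ₗ[ℂ] (Q ⟶ P) where
  toFun ι := unbendUnit ι
  map_add' f g := by simp [unbendUnit, LinearBicategory.add_whiskerRight]
  map_smul' r f := by simp [unbendUnit, LinearBicategory.smul_whiskerRight]

/-- `loopLeft` as a linear map. -/
def loopLeftₗ (X : o ⟶ a) : (X ⟶ X) →ₗ[ℂ] (𝟙 o ⟶ 𝟙 o) where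
  toFun Ψ := loopLeft X Ψ
  map_add' f g := by simp [loopLeft, LinearBicategory.add_whiskerRight]
  map_smul' r f := by simp [loopLeft, LinearBicategory.smul_whiskerRight]

theorem whiskerLeft_betaUp_act_eq_sum {A : FrobeniusAlgebra a} (Q P : LeftModule A o) (n : ℕ)
    (ι : Fin n → (𝟙 o ⟶ P.Q ≫ dual Q.Q)) (π : Fin n → (P.Q ≫ dual Q.Q ⟶ 𝟙 o))
    (hsum : ∑ k, π k ≫ ι k = 𝟙 (P.Q ≫ dual Q.Q)) (Φ : Q.Q ⟶ Q.Q) :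
    (ρ_ P.Q).inv ≫ P.Q ◁ betaUp Q Φ ≫ P.act =
      ∑ k, unbendCounit (π k) ≫ Φ ≫ average Q P (unbendUnit (ι k)) := by
  have h := unbend_id_eq_whiskerLeft_loop (P := P.Q) A.X (Φ ≫ Q.coact)
  rw [← hsum, sum_whiskerRight] at h
  simp only [Preadditive.sum_comp, Preadditive.comp_sum, ← unbendCounit_comp_unbendUnit] at h
  unfold betaUp
  rw [← Category.assoc, ← h]
  simp [Preadditive.sum_comp, average]

/-- The coordinate `f ↦ ⟨loop of f ∘ g⟩` on `Hom(Q, P)` given by `g : P ⟶ Q`. -/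
def loopCoord (tr : ∀ a : B, (𝟙 a ⟶ 𝟙 a) →ₗ[ℂ] ℂ) {Q P : o ⟶ a} (g : P ⟶ Q) :
    (Q ⟶ P) →ₗ[ℂ] ℂ :=
  tr o ∘ₗ loopLeftₗ P ∘ₗ Linear.leftComp ℂ P g

theorem sum_loopCoord_smul (ho : IsTrivialTheory tr o) {Q P : o ⟶ a} {n : ℕ}
    {ι : Fin n → (𝟙 o ⟶ P ≫ dual Q)} {π : Fin n → (P ≫ dual Q ⟶ 𝟙 o)}
    (hsum : ∑ k, π k ≫ ι k = 𝟙 (P ≫ dual Q)) (f : Q ⟶ P) :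
    ∑ k, loopCoord tr (unbendCounit (π k)) f • unbendUnit (ι k) = f := by
  -- By cyclicity the loop is the bent `f` followed by `π k`; as an element of `End(I_0)` it is its
  -- own bulk trace times the identity.
  have key : ∀ k, loopCoord tr (unbendCounit (π k)) f • ι k =
      ((adjR Q).unit ≫ f ▷ dual Q) ≫ π k ≫ ι k := by
    intro k
    have h1 : loopLeft P (unbendCounit (π k) ≫ f) =
        ((adjR Q).unit ≫ f ▷ dual Q) ≫ π k := by
      rw [loopLeft_comp_comm]
      simp [loopLeft, unbendCounit_whiskerRight]
    have h2 : loopCoord tr (unbendCounit (π k)) f =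
        tr o (loopLeft P (unbendCounit (π k) ≫ f)) := rfl
    rw [h2, ← Category.assoc, ← h1]
    conv_rhs => rw [ho.eq_tr_smul (loopLeft P (unbendCounit (π k) ≫ f))]
    simp
  have h := congrArg (unbendUnitₗ Q P) (show ∑ k, loopCoord tr (unbendCounit (π k)) f • ι k =
      (adjR Q).unit ≫ f ▷ dual Q by
    simp_rw [key]
    rw [← Preadditive.comp_sum, hsum, Category.comp_id])
  rw [map_sum] at h
  simp only [map_smul] at h
  exact h.trans (unbendUnit_unit f)

end Linear

/-- The reconstruction identity writes `T` as a sum of rank-one maps, so the `x k` need not be a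
basis. -/
theorem trace_eq_sum_of_sum_smul_eq {K W : Type*} [Field K] [AddCommGroup W] [Module K W]
    [FiniteDimensional K W] {n : ℕ} (φ : Fin n → (W →ₗ[K] K)) (x : Fin n → W)
    (h : ∀ w, ∑ k, φ k w • x k = w) (T : W →ₗ[K] W) :
    LinearMap.trace K W T = ∑ k, φ k (T (x k)) := by
  have hT : T = ∑ k, (φ k).smulRight (T (x k)) := by
    ext w
    conv_lhs => rw [← h w]
    simp
  conv_lhs => rw [hT]
  simp [LinearMap.trace_smulRight]

theorem finiteDimensional_of_sum_smul_eq {K W : Type*} [Field K] [AddCommGroup W] [Module K W]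
    {n : ℕ} (φ : Fin n → (W →ₗ[K] K)) (x : Fin n → W) (h : ∀ w, ∑ k, φ k w • x k = w) :
    FiniteDimensional K W := by
  refine FiniteDimensional.of_surjective (Fintype.linearCombination K x) fun w => ?_
  exact ⟨fun k => φ k w, by simp [Fintype.linearCombination_apply, h]⟩

end GeneralisedOrbifold

theorem mainTheorem1 {B : Type u} [Bicategory.{w, v} B]
    [GeneralisedOrbifold.LinearBicategory B] [GeneralisedOrbifold.PivotalBicategory B]
    (tr : ∀ a : B, (𝟙 a ⟶ 𝟙 a) →ₗ[ℂ] ℂ) (htr : GeneralisedOrbifold.OrientationFlip tr)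
    (o : B) (ho : GeneralisedOrbifold.IsTrivialTheory tr o)
    (a : B) (A : GeneralisedOrbifold.FrobeniusAlgebra a) (hA : A.IsSeparable)
    (Q P : GeneralisedOrbifold.LeftModule A o)
    (Φ : GeneralisedOrbifold.moduleHom Q Q) (Ψ : GeneralisedOrbifold.moduleHom P P) :
    FiniteDimensional ℂ (GeneralisedOrbifold.moduleHom Q P) ∧
    GeneralisedOrbifold.orbifoldTrace tr A
        (GeneralisedOrbifold.bulkMul A
          (GeneralisedOrbifold.betaUp Q Φ.1) (GeneralisedOrbifold.betaUp P Ψ.1)) =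
      LinearMap.trace ℂ (GeneralisedOrbifold.moduleHom Q P)
        (GeneralisedOrbifold.sandwich Q P Φ Ψ) := by
  open GeneralisedOrbifold in
  obtain ⟨n, ι, π, -, hsum⟩ := ho.directSum (P.Q ≫ PivotalBicategory.dual Q.Q)
  have hcoord := sum_loopCoord_smul ho hsum
  have : FiniteDimensional ℂ (Q.Q ⟶ P.Q) := finiteDimensional_of_sum_smul_eq _ _ hcoord
  refine ⟨inferInstance, ?_⟩
  have havg : averageₗ Q P ∘ₗ (moduleHom Q P).subtype = LinearMap.id := by
    ext f
    exact average_eq_self hA Q P f.1 f.2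
  have hΨ : Ψ.1 ▷ A.X ≫ P.act = P.act ≫ Ψ.1 := Ψ.2
  rw [orbifoldTrace, bulkMul_betaUp_counit, ← htr]
  calc
    -- `Ψ` is a module map, so it moves past the action of `β^Q(Φ)`.
    _ = tr o (loopLeft P.Q (((ρ_ P.Q).inv ≫ P.Q ◁ betaUp Q Φ.1 ≫ P.act) ≫ Ψ.1)) := by
      congr 2
      simp only [Category.assoc]
      rw [← hΨ, whisker_exchange_assoc]
      simp
    _ = ∑ k, tr o (loopLeft P.Q
          (unbendCounit (π k) ≫ Φ.1 ≫ average Q P (unbendUnit (ι k)) ≫ Ψ.1)) := by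
      rw [whiskerLeft_betaUp_act_eq_sum Q P n ι π hsum, Preadditive.sum_comp]
      simp only [Category.assoc]
      exact (congrArg (tr o) (map_sum (loopLeftₗ P.Q) _ _)).trans (map_sum (tr o) _ _)
    _ = LinearMap.trace ℂ (Q.Q ⟶ P.Q)
          ((moduleHom Q P).subtype ∘ₗ sandwich Q P Φ Ψ ∘ₗ averageₗ Q P) :=
      (trace_eq_sum_of_sum_smul_eq _ _ hcoord
        ((moduleHom Q P).subtype ∘ₗ sandwich Q P Φ Ψ ∘ₗ averageₗ Q P)).symm
    _ = _ := by
      -- Cyclicity brings the inclusion next to `averageₗ`, where the two compose to the identity of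
      -- `Hom_A(Q,P)`.
      rw [LinearMap.trace_comp_comm', LinearMap.comp_assoc, havg, LinearMap.comp_id]
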